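/- An \emph{idempotent semifield} is a commutative semiring $(F,+,\times,0,1)$ with $0\neq 1$ in which every nonzero element has a multiplicative inverse and $x+x=x$ for all $x$; morphisms are semiring homomorphisms (preserving $+,\times,0,1$). An \emph{abelian $\ell$-group} is an abelian group with a translation-invariant lattice order; morphisms are the maps that are both group and lattice homomorphisms. An \emph{MV-algebra} is a structure $(A,\oplus,0,1,\neg)$ such that $(A,\oplus,0)$ is a commutative monoid, $\neg 0=1$, $x\oplus 1=1$, $\neg\neg x=x$ and $\neg(\neg x\oplus y)\oplus y=\neg(\neg y\oplus x)\oplus x$; morphisms preserve $\oplus,0,1,\neg$. Put $x\le y$ iff $y=x\oplus z$ for some $z$; an element $x$ is \emph{infinitesimal} if $nx=x\oplus\dots\oplus x\le\neg x$ for every integer $n\ge 1$, and the set of infinitesimals is the \emph{radical}. An MV-algebra is \emph{perfect} if $0\ne 1$ and it is generated, as an MV-algebra, by its radical; perfect MV-algebras form a full subcategory of the category of MV-algebras. Let $\rho$ be the functor from idempotent semifields to abelian $\ell$-groups sending $F$ to the multiplicative group $F\setminus\{0\}$ ordered by $x\le y\iff x+y=y$, and a homomorphism to its restriction. For an abelian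 $\ell$-group $H$ with a strong unit $u$ (i.e. $u\ge 0$ and for every $h\in H$ there is $n\ge1$ with $h\le nu$), let $\Gamma(H,u)$ be the MV-algebra on the interval $[0,u]$ with $x\oplus y=(x+y)\wedge u$, $\neg x=u-x$, zero $0$ and one $u$. Let $\Delta$ be the functor from abelian $\ell$-groups to perfect MV-algebras given by $\Delta(G)=\Gamma(\mathbb Z\times_{\mathrm{lex}}G,(1,0))$, where $\mathbb Z\times_{\mathrm{lex}}G$ is the product group with the lexicographic order ($\mathbb Z$-coordinate first), acting on a morphism $f$ by $(n,g)\mapsto(n,f(g))$. \textbf{Theorem.} The functors $\rho$ and $\Delta$ are equivalences of categories; consequently the composite $\Delta\circ\rho$ is an equivalence from the category of idempotent semifields to the category of perfect MV-algebras. -/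

import Mathlib

universe u

open CategoryTheory

/-! ### Idempotent semifields -/

/-- An idempotent semifield: a commutative semiring with `0 ≠ 1` in which every nonzero element is
invertible and `x + x = x` for all `x`. -/
structure IdemSemifield : Type (u + 1) where
  carrier : Type u
  [semifield : Semifield carrier]
  add_self : ∀ x : carrier, x + x = x

namespace IdemSemifield

attribute [instance] IdemSemifield.semifield

/-- Morphisms are the semiring homomorphisms (preserving `+`, `*`, `0`, `1`). -/
@[ext]
structure Hom (F K : IdemSemifield.{u}) where
  toRingHom : F.carrier →+* K.carrier

instance : Category IdemSemifield.{u} where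
  Hom F K := Hom F K
  id F := ⟨RingHom.id F.carrier⟩
  comp f g := ⟨g.toRingHom.comp f.toRingHom⟩

end IdemSemifield

/-! ### Abelian lattice-ordered groups -/

/-- An abelian ℓ-group, written additively. -/
structure AbLGroup : Type (u + 1) where
  carrier : Type u
  [addCommGroup : AddCommGroup carrier]
  [lattice : Lattice carrier]
  [isOrdered : IsOrderedAddMonoid carrier]

namespace AbLGroup

attribute [instance] AbLGroup.addCommGroup AbLGroup.lattice AbLGroup.isOrdered

/-- Homomorphisms of ℓ-groups: maps that are group and lattice homomorphisms. -/
@[ext]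
structure Hom (G H : AbLGroup.{u}) where
  toFun : G.carrier → H.carrier
  map_add : ∀ x y, toFun (x + y) = toFun x + toFun y
  map_sup : ∀ x y, toFun (x ⊔ y) = toFun x ⊔ toFun y
  map_inf : ∀ x y, toFun (x ⊓ y) = toFun x ⊓ toFun y

/-- An ℓ-group homomorphism as a homomorphism of additive groups. -/
def Hom.toAddMonoidHom {G H : AbLGroup.{u}} (f : Hom G H) : G.carrier →+ H.carrier :=
  AddMonoidHom.mk' f.toFun f.map_add

theorem Hom.map_zero {G H : AbLGroup.{u}} (f : Hom G H) : f.toFun 0 = 0 :=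
  f.toAddMonoidHom.map_zero

theorem Hom.map_sub {G H : AbLGroup.{u}} (f : Hom G H) (x y : G.carrier) :
    f.toFun (x - y) = f.toFun x - f.toFun y :=
  f.toAddMonoidHom.map_sub x y

theorem Hom.monotone {G H : AbLGroup.{u}} (f : Hom G H) {x y : G.carrier} (h : x ≤ y) :
    f.toFun x ≤ f.toFun y := by
  rw [← sup_eq_right, ← f.map_sup, sup_eq_right.2 h]

instance : Category AbLGroup.{u} where
  Hom G H := Hom G H
  id G := ⟨id, fun _ _ => rfl, fun _ _ => rfl, fun _ _ => rfl⟩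
  comp f g := ⟨g.toFun ∘ f.toFun,
    fun x y => by simp [f.map_add, g.map_add],
    fun x y => by simp [f.map_sup, g.map_sup],
    fun x y => by simp [f.map_inf, g.map_inf]⟩

end AbLGroup

/-- An abelian ℓ-group with a distinguished strong unit. -/
structure UnitalAbLGroup : Type (u + 1) where
  group : AbLGroup.{u}
  unit : group.carrier
  unit_nonneg : 0 ≤ unit
  unit_strong : ∀ g : group.carrier, ∃ n : ℕ, 1 ≤ n ∧ g ≤ n • unit

namespace UnitalAbLGroup

/-- Unital ℓ-group homomorphisms: ℓ-group homomorphisms preserving the distinguished unit. -/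
@[ext]
structure Hom (G H : UnitalAbLGroup.{u}) where
  toHom : AbLGroup.Hom G.group H.group
  map_unit : toHom.toFun G.unit = H.unit

instance : Category UnitalAbLGroup.{u} where
  Hom G H := Hom G H
  id G := ⟨𝟙 G.group, rfl⟩
  comp {G H K} f g := ⟨CategoryStruct.comp (X := G.group) (Y := H.group) (Z := K.group)
    f.toHom g.toHom, (congrArg g.toHom.toFun f.map_unit).trans g.map_unit⟩

end UnitalAbLGroup

/-! ### MV-algebras -/

/-- MV-algebras `(A, ⊕, 0, 1, ¬)`. -/
class MVAlgebra (A : Type u) where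
  oplus : A → A → A
  zero : A
  one : A
  neg : A → A
  oplus_assoc : ∀ x y z, oplus (oplus x y) z = oplus x (oplus y z)
  oplus_comm : ∀ x y, oplus x y = oplus y x
  oplus_zero : ∀ x, oplus x zero = x
  neg_zero : neg zero = one
  oplus_one : ∀ x, oplus x one = one
  neg_neg : ∀ x, neg (neg x) = x
  lukasiewicz : ∀ x y, oplus (neg (oplus (neg x) y)) y = oplus (neg (oplus (neg y) x)) x

namespace MVAlgebra

variable {A : Type u} [MVAlgebra A]

/-- The natural order: `x ≤ y` iff `y = x ⊕ z` for some `z`. -/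
def le (x y : A) : Prop := ∃ z, y = oplus x z

/-- The `n`-fold sum `n x = x ⊕ ⋯ ⊕ x`. -/
def nmul : ℕ → A → A
  | 0, _ => zero
  | n + 1, x => oplus (nmul n x) x

/-- `x` is infinitesimal if `n x ≤ ¬ x` for every positive integer `n`. -/
def IsInfinitesimal (x : A) : Prop := ∀ n : ℕ, 1 ≤ n → le (nmul n x) (neg x)

variable (A) in
/-- The radical: the set of all infinitesimals. -/
def rad : Set A := {x | IsInfinitesimal x}

/-- Membership in the MV-subalgebra generated by a set `S`. -/
inductive Generated (S : Set A) : A → Prop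
  | of {x : A} : x ∈ S → Generated S x
  | zero : Generated S zero
  | one : Generated S one
  | oplus {x y : A} : Generated S x → Generated S y → Generated S (oplus x y)
  | neg {x : A} : Generated S x → Generated S (neg x)

variable (A) in
/-- A perfect MV-algebra is a nontrivial MV-algebra generated by its radical. -/
def IsPerfect : Prop := (zero : A) ≠ one ∧ ∀ x : A, Generated (rad A) x

end MVAlgebra

/-- Bundled MV-algebras. -/
structure MVAlg : Type (u + 1) where
  carrier : Type u
  [mvAlgebra : MVAlgebra carrier]

namespace MVAlg

attribute [instance] MVAlg.mvAlgebra

/-- Homomorphisms of MV-algebras. -/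
@[ext]
structure Hom (A B : MVAlg.{u}) where
  toFun : A.carrier → B.carrier
  map_oplus : ∀ x y, toFun (MVAlgebra.oplus x y) = MVAlgebra.oplus (toFun x) (toFun y)
  map_zero : toFun MVAlgebra.zero = MVAlgebra.zero
  map_one : toFun MVAlgebra.one = MVAlgebra.one
  map_neg : ∀ x, toFun (MVAlgebra.neg x) = MVAlgebra.neg (toFun x)

instance : Category MVAlg.{u} where
  Hom A B := Hom A B
  id A := ⟨id, fun _ _ => rfl, rfl, rfl, fun _ => rfl⟩
  comp f g := ⟨g.toFun ∘ f.toFun,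
    fun x y => by simp [f.map_oplus, g.map_oplus],
    by simp [f.map_zero, g.map_zero],
    by simp [f.map_one, g.map_one],
    fun x => by simp [f.map_neg, g.map_neg]⟩

/-- The property of being a perfect MV-algebra. -/
def perfect : ObjectProperty MVAlg.{u} := fun A => MVAlgebra.IsPerfect A.carrier

end MVAlg

/-- The category of perfect MV-algebras: the full subcategory of MV-algebras on the perfect ones. -/
abbrev PerfectMVAlg : Type (u + 1) := MVAlg.perfect.{u}.FullSubcategory

/-! ### The functor `ρ` -/

namespace IdemSemifield

variable (F : IdemSemifield.{u})

theorem add_ne_zero {x y : F.carrier} (hx : x ≠ 0) : x + y ≠ 0 := by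
  intro h
  apply hx
  calc x = x + (x + y) := by rw [h, add_zero]
    _ = x + y := by rw [← add_assoc, F.add_self]
    _ = 0 := h

/-- The sum of two nonzero elements, as a nonzero element. -/
def unitsAdd (a b : (F.carrier)ˣ) : (F.carrier)ˣ :=
  Units.mk0 ((a : F.carrier) + b) (F.add_ne_zero a.ne_zero)

theorem val_unitsAdd (a b : (F.carrier)ˣ) :
    ((F.unitsAdd a b : (F.carrier)ˣ) : F.carrier) = (a : F.carrier) + b := rfl

theorem inv_add_inv_iff (a b : (F.carrier)ˣ) :
    ((b⁻¹ : (F.carrier)ˣ) : F.carrier) + (a⁻¹ : (F.carrier)ˣ) = (a⁻¹ : (F.carrier)ˣ) ↔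
      (a : F.carrier) + b = b := by
  have ha := a.ne_zero
  have hb := b.ne_zero
  rw [Units.val_inv_eq_inv_val, Units.val_inv_eq_inv_val]
  constructor
  · intro h
    have := congrArg (fun t => (a : F.carrier) * b * t) h
    simp only [mul_add] at this
    rwa [mul_inv_cancel_right₀ hb, mul_comm (a : F.carrier) b, mul_inv_cancel_right₀ ha] at this
  · intro h
    have := congrArg (fun t => (a : F.carrier)⁻¹ * (b : F.carrier)⁻¹ * t) h
    simp only [mul_add] at this
    rwa [inv_mul_cancel_right₀ hb, mul_comm (a : F.carrier)⁻¹, inv_mul_cancel_right₀ ha] at this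

/-- The lattice structure on the group `F ∖ {0}` (realised as the units of `F`, written
additively): `x ≤ y` iff `x + y = y` in `F`; the join is the sum of `F`, and the meet
is `(x⁻¹ + y⁻¹)⁻¹`. -/
@[reducible]
def unitsLattice : Lattice (Additive (F.carrier)ˣ) where
  le a b := (a.toMul : F.carrier) + (b.toMul : F.carrier) = (b.toMul : F.carrier)
  le_refl a := F.add_self _
  le_trans a b c hab hbc := by rw [← hbc, ← add_assoc, hab]
  le_antisymm a b hab hba := by
    apply Additive.toMul.injective
    apply Units.ext
    rw [← hba, add_comm, hab]
  sup a b := Additive.ofMul (F.unitsAdd a.toMul b.toMul)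
  le_sup_left a b := by
    change _ + (_ + _) = (_ + _)
    rw [← add_assoc, F.add_self]
  le_sup_right a b := by
    change _ + (_ + _) = (_ + _)
    rw [add_left_comm, F.add_self]
  sup_le a b c hac hbc := by
    change (_ + _) + _ = _
    rw [add_assoc, hbc, hac]
  inf a b := Additive.ofMul (F.unitsAdd (a.toMul)⁻¹ (b.toMul)⁻¹)⁻¹
  inf_le_left a b := by
    rw [← F.inv_add_inv_iff, toMul_ofMul, inv_inv, val_unitsAdd, ← add_assoc, F.add_self]
  inf_le_right a b := by
    rw [← F.inv_add_inv_iff, toMul_ofMul, inv_inv, val_unitsAdd, add_left_comm, F.add_self]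
  le_inf a b c hab hac := by
    rw [← F.inv_add_inv_iff] at hab hac ⊢
    rw [toMul_ofMul, inv_inv, val_unitsAdd, add_assoc, hac, hab]

/-- The abelian ℓ-group `(F ∖ {0}, ·, 1)`, written additively. -/
def rhoObj : AbLGroup.{u} :=
  letI := F.unitsLattice
  { carrier := Additive (F.carrier)ˣ
    isOrdered :=
      { add_le_add_left := fun a b hab c => by
          change ((a.toMul * c.toMul : (F.carrier)ˣ) : F.carrier) +
            ((b.toMul * c.toMul : (F.carrier)ˣ) : F.carrier) = (b.toMul * c.toMul : (F.carrier)ˣ)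
          have h : (a.toMul : F.carrier) + (b.toMul : F.carrier) = (b.toMul : F.carrier) := hab
          rw [Units.val_mul, Units.val_mul, ← add_mul, h] } }

variable {F} {K : IdemSemifield.{u}}

/-- The restriction of a semiring homomorphism to the nonzero elements. -/
def rhoMap (f : F.carrier →+* K.carrier) (a : Additive (F.carrier)ˣ) : Additive (K.carrier)ˣ :=
  Additive.ofMul (Units.map (f : F.carrier →* K.carrier) a.toMul)

theorem rhoMap_add (f : F.carrier →+* K.carrier) (a b : Additive (F.carrier)ˣ) :
    rhoMap f (a + b) = rhoMap f a + rhoMap f b :=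
  congrArg Additive.ofMul (map_mul (Units.map (f : F.carrier →* K.carrier)) a.toMul b.toMul)

theorem map_unitsAdd (f : F.carrier →+* K.carrier) (a b : (F.carrier)ˣ) :
    Units.map (f : F.carrier →* K.carrier) (F.unitsAdd a b) =
      K.unitsAdd (Units.map (f : F.carrier →* K.carrier) a)
        (Units.map (f : F.carrier →* K.carrier) b) :=
  Units.ext (map_add f (a : F.carrier) (b : F.carrier))

theorem rhoMap_sup (f : F.carrier →+* K.carrier) (a b : Additive (F.carrier)ˣ) :
    rhoMap f (F.unitsLattice.sup a b) = K.unitsLattice.sup (rhoMap f a) (rhoMap f b) :=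
  congrArg Additive.ofMul (map_unitsAdd f a.toMul b.toMul)

theorem rhoMap_inf (f : F.carrier →+* K.carrier) (a b : Additive (F.carrier)ˣ) :
    rhoMap f (F.unitsLattice.inf a b) = K.unitsLattice.inf (rhoMap f a) (rhoMap f b) := by
  refine congrArg Additive.ofMul ?_
  change Units.map (f : F.carrier →* K.carrier) (F.unitsAdd (a.toMul)⁻¹ (b.toMul)⁻¹)⁻¹ = _
  rw [map_inv, map_unitsAdd, map_inv, map_inv]
  rfl

end IdemSemifield

/-- Rump's functor `ρ`, sending an idempotent semifield `F` to the abelian ℓ-group `F ∖ {0}` and a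
homomorphism to its restriction. -/
def rho : IdemSemifield.{u} ⥤ AbLGroup.{u} where
  obj F := F.rhoObj
  map {F K} f :=
    { toFun := IdemSemifield.rhoMap f.toRingHom
      map_add := IdemSemifield.rhoMap_add f.toRingHom
      map_sup := IdemSemifield.rhoMap_sup f.toRingHom
      map_inf := IdemSemifield.rhoMap_inf f.toRingHom }

/-! ### Mundici's functor `Γ` -/

/-- The MV-algebra structure on the interval `[0, u]` of an abelian ℓ-group:
`x ⊕ y = (x + y) ⊓ u` and `¬ x = u - x`. -/
@[reducible]
def intervalMV {G : Type u} [AddCommGroup G] [Lattice G] [IsOrderedAddMonoid G] (u : G)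
    (hu : 0 ≤ u) : MVAlgebra (Set.Icc (0 : G) u) where
  oplus x y := ⟨(x.1 + y.1) ⊓ u, le_inf (add_nonneg x.2.1 y.2.1) hu, inf_le_right⟩
  zero := ⟨0, le_rfl, hu⟩
  one := ⟨u, hu, le_rfl⟩
  neg x := ⟨u - x.1, sub_nonneg.2 x.2.2, sub_le_self _ x.2.1⟩
  oplus_assoc x y z := Subtype.ext <| by
    have h1 : u ≤ u + z.1 := le_add_of_nonneg_right z.2.1
    have h2 : u ≤ x.1 + u := le_add_of_nonneg_left x.2.1
    change ((x.1 + y.1) ⊓ u + z.1) ⊓ u = (x.1 + (y.1 + z.1) ⊓ u) ⊓ u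
    rw [inf_add, add_inf, inf_assoc, inf_assoc, inf_eq_right.2 h1, inf_eq_right.2 h2, add_assoc]
  oplus_comm x y := Subtype.ext <| by
    change (x.1 + y.1) ⊓ u = (y.1 + x.1) ⊓ u
    rw [add_comm]
  oplus_zero x := Subtype.ext <| by
    change (x.1 + 0) ⊓ u = x.1
    rw [add_zero, inf_eq_left.2 x.2.2]
  neg_zero := Subtype.ext (sub_zero u)
  oplus_one x := Subtype.ext (inf_eq_right.2 (le_add_of_nonneg_left x.2.1))
  neg_neg x := Subtype.ext (sub_sub_cancel u x.1)
  lukasiewicz x y := Subtype.ext <| by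
    have key : ∀ a b : G, u - ((u - a + b) ⊓ u) + b = a ⊔ b := fun a b => by
      rw [sub_eq_add_neg, neg_inf, add_sup, sup_add]
      congr 1 <;> abel
    change (u - ((u - x.1 + y.1) ⊓ u) + y.1) ⊓ u = (u - ((u - y.1 + x.1) ⊓ u) + x.1) ⊓ u
    rw [key, key, sup_comm]

section interval

variable {G : Type u} [AddCommGroup G] [Lattice G] [IsOrderedAddMonoid G]

theorem intervalMV_le {u : G} (hu : 0 ≤ u) (x y : Set.Icc (0 : G) u) (h : x.1 ≤ y.1) :
    @MVAlgebra.le _ (intervalMV u hu) x y := by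
  refine ⟨⟨y.1 - x.1, sub_nonneg.2 h, (sub_le_self _ x.2.1).trans y.2.2⟩, Subtype.ext ?_⟩
  change y.1 = (x.1 + (y.1 - x.1)) ⊓ u
  rw [add_sub_cancel, inf_eq_left.2 y.2.2]

theorem intervalMV_nmul {u : G} (hu : 0 ≤ u) (x : Set.Icc (0 : G) u)
    (h : ∀ n : ℕ, n • x.1 ≤ u) (n : ℕ) :
    (@MVAlgebra.nmul _ (intervalMV u hu) n x).1 = n • x.1 := by
  induction n with
  | zero => exact (zero_nsmul _).symm
  | succ n ih =>
    change ((@MVAlgebra.nmul _ (intervalMV u hu) n x).1 + x.1) ⊓ u = _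
    rw [ih, ← succ_nsmul, inf_eq_left.2 (h _)]

theorem intervalMV_infinitesimal {u : G} (hu : 0 ≤ u) (x : Set.Icc (0 : G) u)
    (h : ∀ n : ℕ, n • x.1 ≤ u) : @MVAlgebra.IsInfinitesimal _ (intervalMV u hu) x := by
  intro n _
  apply intervalMV_le
  rw [intervalMV_nmul hu x h]
  change n • x.1 ≤ u - x.1
  rw [le_sub_iff_add_le, ← succ_nsmul]
  exact h _

end interval

/-- Mundici's functor `Γ`, sending `(G, u)` to the MV-algebra `[0, u]` and a unital ℓ-group
homomorphism to its restriction. -/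
def Gamma : UnitalAbLGroup.{u} ⥤ MVAlg.{u} where
  obj G := @MVAlg.mk (Set.Icc (0 : G.group.carrier) G.unit) (intervalMV G.unit G.unit_nonneg)
  map {G H} f :=
    { toFun := fun x : Set.Icc (0 : G.group.carrier) G.unit =>
        (⟨f.toHom.toFun x.1,
          (f.toHom.map_zero).symm.le.trans (f.toHom.monotone x.2.1),
          (f.toHom.monotone x.2.2).trans f.map_unit.le⟩ : Set.Icc (0 : H.group.carrier) H.unit)
      map_oplus := fun x y => Subtype.ext <|
        (f.toHom.map_inf _ _).trans (congrArg₂ (· ⊓ ·) (f.toHom.map_add _ _) f.map_unit)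
      map_zero := Subtype.ext f.toHom.map_zero
      map_one := Subtype.ext f.map_unit
      map_neg := fun x => Subtype.ext <|
        (f.toHom.map_sub _ _).trans (congrArg (· - _) f.map_unit) }

/-! ### The lexicographic product `ℤ ×ₗ G` and the functor `Δ` -/

/-- The lattice structure of the lexicographic order on `ℤ × G`. The order is Mathlib's
lexicographic order. -/
@[reducible]
noncomputable def lexLattice (G : Type u) [Lattice G] : Lattice (ℤ ×ₗ G) where
  __ := Prod.Lex.instPartialOrder ℤ G
  sup x y := if (ofLex x).1 < (ofLex y).1 then y else if (ofLex y).1 < (ofLex x).1 then x else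
    toLex ((ofLex x).1, (ofLex x).2 ⊔ (ofLex y).2)
  inf x y := if (ofLex x).1 < (ofLex y).1 then x else if (ofLex y).1 < (ofLex x).1 then y else
    toLex ((ofLex x).1, (ofLex x).2 ⊓ (ofLex y).2)
  le_sup_left x y := by
    split_ifs with h1 h2
    · exact Prod.Lex.le_iff.2 (Or.inl h1)
    · exact le_rfl
    · exact Prod.Lex.le_iff.2 (Or.inr ⟨rfl, le_sup_left⟩)
  le_sup_right x y := by
    split_ifs with h1 h2
    · exact le_rfl
    · exact Prod.Lex.le_iff.2 (Or.inl h2)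
    · exact Prod.Lex.le_iff.2 (Or.inr ⟨le_antisymm (not_lt.1 h1) (not_lt.1 h2), le_sup_right⟩)
  sup_le x y z hx hy := by
    split_ifs with h1 h2
    · exact hy
    · exact hx
    · rw [Prod.Lex.le_iff'] at hx hy ⊢
      have h : (ofLex x).1 = (ofLex y).1 := le_antisymm (not_lt.1 h2) (not_lt.1 h1)
      exact ⟨hx.1, fun e => sup_le (hx.2 e) (hy.2 (h.symm.trans e))⟩
  inf_le_left x y := by
    split_ifs with h1 h2
    · exact le_rfl
    · exact Prod.Lex.le_iff.2 (Or.inl h2)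
    · exact Prod.Lex.le_iff.2 (Or.inr ⟨rfl, inf_le_left⟩)
  inf_le_right x y := by
    split_ifs with h1 h2
    · exact Prod.Lex.le_iff.2 (Or.inl h1)
    · exact le_rfl
    · exact Prod.Lex.le_iff.2 (Or.inr ⟨le_antisymm (not_lt.1 h2) (not_lt.1 h1), inf_le_right⟩)
  le_inf x y z hy hz := by
    split_ifs with h1 h2
    · exact hy
    · exact hz
    · rw [Prod.Lex.le_iff'] at hy hz ⊢
      have h : (ofLex y).1 = (ofLex z).1 := le_antisymm (not_lt.1 h2) (not_lt.1 h1)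
      exact ⟨hy.1, fun e => le_inf (hy.2 e) (hz.2 (e.trans h))⟩

namespace AbLGroup

/-- The abelian ℓ-group `ℤ ×_lex G` with componentwise addition and lexicographic order. -/
noncomputable def lexZ (G : AbLGroup.{u}) : AbLGroup.{u} :=
  letI := lexLattice G.carrier
  { carrier := ℤ ×ₗ G.carrier
    isOrdered := Prod.Lex.isOrderedAddMonoid }

/-- The map `(n, g) ↦ (n, f g)` induced by an ℓ-group homomorphism `f`. -/
def lexZMap {G H : AbLGroup.{u}} (f : Hom G H) : Hom G.lexZ H.lexZ where
  toFun := fun x : ℤ ×ₗ G.carrier =>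
    (toLex ((ofLex x).1, f.toFun (ofLex x).2) : ℤ ×ₗ H.carrier)
  map_add x y := congrArg toLex (Prod.ext rfl (f.map_add _ _))
  map_sup x y := by
    refine (apply_ite (fun x : ℤ ×ₗ G.carrier =>
      (toLex ((ofLex x).1, f.toFun (ofLex x).2) : ℤ ×ₗ H.carrier)) _ _ _).trans ?_
    refine if_congr Iff.rfl rfl ?_
    refine (apply_ite (fun x : ℤ ×ₗ G.carrier =>
      (toLex ((ofLex x).1, f.toFun (ofLex x).2) : ℤ ×ₗ H.carrier)) _ _ _).trans ?_
    exact if_congr Iff.rfl rfl (congrArg toLex (Prod.ext rfl (f.map_sup _ _)))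
  map_inf x y := by
    refine (apply_ite (fun x : ℤ ×ₗ G.carrier =>
      (toLex ((ofLex x).1, f.toFun (ofLex x).2) : ℤ ×ₗ H.carrier)) _ _ _).trans ?_
    refine if_congr Iff.rfl rfl ?_
    refine (apply_ite (fun x : ℤ ×ₗ G.carrier =>
      (toLex ((ofLex x).1, f.toFun (ofLex x).2) : ℤ ×ₗ H.carrier)) _ _ _).trans ?_
    exact if_congr Iff.rfl rfl (congrArg toLex (Prod.ext rfl (f.map_inf _ _)))

end AbLGroup

/-- The functor `G ↦ (ℤ ×_lex G, (1, 0))`. -/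
noncomputable def lexZFunctor : AbLGroup.{u} ⥤ UnitalAbLGroup.{u} where
  obj G :=
    { group := G.lexZ
      unit := (toLex (1, 0) : ℤ ×ₗ G.carrier)
      unit_nonneg := by
        change (0 : ℤ ×ₗ G.carrier) ≤ toLex (1, 0)
        exact Prod.Lex.le_iff.2 (Or.inl one_pos)
      unit_strong := fun g => by
        change ∃ n : ℕ, 1 ≤ n ∧ (show ℤ ×ₗ G.carrier from g) ≤ n • toLex ((1 : ℤ), (0 : G.carrier))
        let g' : ℤ ×ₗ G.carrier := g
        refine ⟨(ofLex g').1.toNat + 1, by omega, Prod.Lex.le_iff.2 (Or.inl ?_)⟩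
        change (ofLex g').1 < (((ofLex g').1.toNat + 1) • ((1 : ℤ)))
        rw [nsmul_eq_mul]
        push_cast
        omega }
  map {G H} f :=
    { toHom := AbLGroup.lexZMap f
      map_unit := congrArg toLex (Prod.ext rfl f.map_zero) }

/-- The MV-algebra `Γ(ℤ ×_lex G, (1, 0))` is perfect. -/
theorem perfect_gamma_lexZ (G : AbLGroup.{u}) :
    MVAlg.perfect ((lexZFunctor ⋙ Gamma).obj G) := by
  let _ := lexLattice G.carrier
  have hu : (0 : ℤ ×ₗ G.carrier) ≤ toLex (1, 0) := Prod.Lex.le_iff.2 (Or.inl one_pos)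
  change @MVAlgebra.IsPerfect (Set.Icc (0 : ℤ ×ₗ G.carrier) (toLex (1, 0)))
    (intervalMV (toLex (1, 0)) hu)
  let _ := intervalMV (toLex ((1 : ℤ), (0 : G.carrier))) hu
  have hinf : ∀ x : Set.Icc (0 : ℤ ×ₗ G.carrier) (toLex (1, 0)), (ofLex x.1).1 = 0 →
      MVAlgebra.IsInfinitesimal x := fun x hx => by
    refine intervalMV_infinitesimal hu x fun n => Prod.Lex.le_iff.2 (Or.inl ?_)
    change n • (ofLex x.1).1 < 1
    rw [hx, smul_zero]
    exact one_pos
  refine ⟨fun h => ?_, fun x => ?_⟩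
  · have h1 : (0 : ℤ) = 1 := congrArg (fun x => (ofLex x.1).1) h
    exact zero_ne_one h1
  · have h0 : (0 : ℤ) ≤ (ofLex x.1).1 := (Prod.Lex.le_iff'.1 x.2.1).1
    have h1 : (ofLex x.1).1 ≤ (1 : ℤ) := (Prod.Lex.le_iff'.1 x.2.2).1
    rcases (by omega : (ofLex x.1).1 = 0 ∨ (ofLex x.1).1 = 1) with h | h
    · exact .of (hinf x h)
    · rw [← MVAlgebra.neg_neg x]
      refine .neg (.of (hinf _ ?_))
      change 1 - (ofLex x.1).1 = 0
      rw [h, sub_self]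

/-- The Di Nola–Lettieri functor `Δ(G) = Γ(ℤ ×_lex G, (1, 0))`. -/
noncomputable def Delta : AbLGroup.{u} ⥤ PerfectMVAlg.{u} :=
  MVAlg.perfect.lift (lexZFunctor ⋙ Gamma) perfect_gamma_lexZ

/-
The inverse of `ρ` adjoins a least element `0` to an ℓ-group. For `Δ`, an ℓ-group is determined by
its positive cone, a cancellative monoid with truncated subtraction, and every such monoid is the
positive cone of its group of differences. The radical of a perfect MV-algebra is such a monoid,
and it determines the algebra, since `x` or `¬ x` is infinitesimal for every `x`. The radical of
`Δ(G)` consists of the elements `(0, g)` with `g ≥ 0`, a copy of the positive cone of `G`.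
-/

open Classical in
/-- The extension by zero of a homomorphism from the units of a group with zero. -/
noncomputable def extendUnits {F K : Type*} [GroupWithZero F] [MonoidWithZero K]
    (f : Fˣ →* Kˣ) : F →*₀ K :=
  (WithZero.lift' ((Units.coeHom K).comp f)).comp (.ofClass WithZero.withZeroUnitsEquiv.symm)

theorem extendUnits_coe {F K : Type*} [GroupWithZero F] [MonoidWithZero K] (f : Fˣ →* Kˣ)
    (x : Fˣ) : extendUnits f (x : F) = f x := by
  classical
  change WithZero.lift' _ (WithZero.withZeroUnitsEquiv.symm (x : F)) = _
  rw [WithZero.withZeroUnitsEquiv_symm_apply_coe, WithZero.lift'_coe]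
  rfl

namespace IdemSemifield

variable {F K : IdemSemifield.{u}}

theorem Hom.ext_of_rhoMap {f g : Hom F K} (h : rhoMap f.toRingHom = rhoMap g.toRingHom) :
    f = g := by
  refine Hom.ext (RingHom.ext fun x => ?_)
  rcases eq_or_ne x 0 with rfl | hx
  · rw [map_zero, map_zero]
  · exact congrArg Units.val
      (Additive.ofMul.injective (congrFun h (Additive.ofMul (Units.mk0 x hx))))

section Extension

variable (f : (F.carrier)ˣ →* (K.carrier)ˣ)
  (hf : ∀ x y, f (F.unitsAdd x y) = K.unitsAdd (f x) (f y))

/-- The extension by zero of a homomorphism of the groups of nonzero elements that preserves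
sums. -/
noncomputable def Hom.ofUnits : Hom F K where
  toRingHom :=
    { extendUnits f with
      map_zero' := map_zero (extendUnits f)
      map_add' := fun x y => by
        change extendUnits f (x + y) = extendUnits f x + extendUnits f y
        rcases eq_or_ne x 0 with rfl | hx
        · rw [zero_add, map_zero, zero_add]
        rcases eq_or_ne y 0 with rfl | hy
        · rw [add_zero, map_zero, add_zero]
        lift x to (F.carrier)ˣ using hx.isUnit
        lift y to (F.carrier)ˣ using hy.isUnit
        rw [← val_unitsAdd, extendUnits_coe, extendUnits_coe, extendUnits_coe, hf, val_unitsAdd] }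

theorem rhoMap_ofUnits (x : (F.carrier)ˣ) :
    rhoMap (Hom.ofUnits f hf).toRingHom (Additive.ofMul x) = Additive.ofMul (f x) :=
  congrArg Additive.ofMul (Units.ext (extendUnits_coe f x))

end Extension

end IdemSemifield

section WithZero

variable {H : Type*} [CommGroup H] [Lattice H] [IsOrderedMonoid H]

theorem mul_sup_withZero (a b c : WithZero H) : a * (b ⊔ c) = a * b ⊔ a * c := by
  rcases eq_or_ne a 0 with rfl | _
  · rw [zero_mul, zero_mul, zero_mul, sup_idem]
  · exact mul_sup₀ zero_le b c

variable (H) in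
/-- The semifield obtained from an abelian ℓ-group, written multiplicatively, by adjoining a least
element `0`; its addition is the join. -/
@[reducible]
noncomputable def withZeroSemifield : Semifield (WithZero H) where
  __ := (inferInstance : CommGroupWithZero (WithZero H))
  add := (· ⊔ ·)
  add_assoc := sup_assoc
  zero_add := bot_sup_eq
  add_zero := sup_bot_eq
  add_comm := sup_comm
  nsmul := @nsmulRec _ ⟨0⟩ ⟨(· ⊔ ·)⟩
  left_distrib := mul_sup_withZero
  right_distrib a b c := by
    rw [mul_comm, mul_comm a, mul_comm b]
    exact mul_sup_withZero c a b
  nnqsmul := _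
  nnqsmul_def _ _ := rfl

end WithZero

namespace AbLGroup

/-- An ordered group isomorphism as a homomorphism of ℓ-groups. -/
def Hom.ofOrderIso {G H : AbLGroup.{u}} (e : G.carrier ≃+o H.carrier) : Hom G H where
  toFun := e
  map_add := e.map_add'
  map_sup := e.toOrderIso.map_sup
  map_inf := e.toOrderIso.map_inf

/-- The isomorphism of ℓ-groups given by an ordered group isomorphism. -/
def isoMk {G H : AbLGroup.{u}} (e : G.carrier ≃+o H.carrier) : G ≅ H where
  hom := Hom.ofOrderIso e
  inv := Hom.ofOrderIso e.symm
  hom_inv_id := Hom.ext (funext fun x => e.symm_apply_apply x)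
  inv_hom_id := Hom.ext (funext fun x => e.apply_symm_apply x)

variable (G : AbLGroup.{u})

instance : Lattice (Multiplicative G.carrier) :=
  inferInstanceAs (Lattice G.carrier)

instance : IsOrderedMonoid (Multiplicative G.carrier) :=
  Multiplicative.isOrderedMonoid

/-- The idempotent semifield `G ∪ {0}`. -/
noncomputable def withZero : IdemSemifield.{u} :=
  letI := withZeroSemifield (Multiplicative G.carrier)
  { carrier := WithZero (Multiplicative G.carrier)
    add_self := sup_idem (α := WithZero (Multiplicative G.carrier)) }

/-- The isomorphism between an ℓ-group and the group of nonzero elements of `G ∪ {0}`. -/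
noncomputable def rhoWithZeroIso : rho.obj G.withZero ≅ G :=
  isoMk (G := rho.obj G.withZero)
    { (WithZero.unitsWithZeroEquiv (α := Multiplicative G.carrier)).toAdditiveLeft with
      map_le_map_iff' {a b} := by
        let x : (WithZero (Multiplicative G.carrier))ˣ := a.toMul
        let y : (WithZero (Multiplicative G.carrier))ˣ := b.toMul
        change WithZero.unitsWithZeroEquiv x ≤ WithZero.unitsWithZeroEquiv y ↔
          (x : WithZero (Multiplicative G.carrier)) ⊔ y = y
        rw [sup_eq_right, ← WithZero.coe_le_coe, WithZero.coe_unitsWithZeroEquiv_eq_units_val,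
          WithZero.coe_unitsWithZeroEquiv_eq_units_val] }

end AbLGroup

instance : rho.{u}.Faithful where
  map_injective h := IdemSemifield.Hom.ext_of_rhoMap (congrArg AbLGroup.Hom.toFun h)

instance : rho.{u}.Full where
  map_surjective {F K} h :=
    let f : (F.carrier)ˣ →* (K.carrier)ˣ := AddMonoidHom.toMultiplicative h.toAddMonoidHom
    ⟨.ofUnits f h.map_sup, AbLGroup.Hom.ext (funext (IdemSemifield.rhoMap_ofUnits f h.map_sup))⟩

instance : rho.{u}.EssSurj where
  mem_essImage G := ⟨G.withZero, ⟨G.rhoWithZeroIso⟩⟩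

namespace MVAlgebra

section Arithmetic

variable {A : Type u} [MVAlgebra A] {w x y z : A}

instance : AddCommMonoid A where
  add := oplus
  zero := zero
  add_assoc := oplus_assoc
  add_comm := oplus_comm
  zero_add x := (oplus_comm zero x).trans (oplus_zero x)
  add_zero := oplus_zero
  nsmul := nmul
  nsmul_zero _ := rfl
  nsmul_succ _ _ := rfl

theorem neg_one : neg (one : A) = 0 := by
  rw [← MVAlgebra.neg_zero, neg_neg]; rfl

theorem add_one (x : A) : x + one = one :=
  oplus_one x

theorem neg_add_self (x : A) : neg x + x = one := by
  have h : neg (neg one + x) + x = neg (neg x + one) + one := lukasiewicz one x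
  rwa [neg_one, zero_add, add_one] at h

theorem le_iff_neg_add_eq_one : le x y ↔ neg x + y = one := by
  constructor
  · rintro ⟨z, rfl⟩
    change neg x + (x + z) = one
    rw [← add_assoc, neg_add_self, add_comm, add_one]
  · intro h
    have key : neg (neg x + y) + y = neg (neg y + x) + x := lukasiewicz x y
    rw [h, neg_one, zero_add] at key
    exact ⟨neg (neg y + x), key.trans (add_comm _ _)⟩

instance : PartialOrder A where
  le := le
  le_refl x := le_iff_neg_add_eq_one.2 (neg_add_self x)
  le_trans := by
    rintro x _ _ ⟨z, rfl⟩ ⟨w, rfl⟩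
    exact ⟨z + w, add_assoc x z w⟩
  le_antisymm x y hxy hyx := by
    have key : neg (neg x + y) + y = neg (neg y + x) + x := lukasiewicz x y
    rw [le_iff_neg_add_eq_one.1 hxy, le_iff_neg_add_eq_one.1 hyx, neg_one, zero_add,
      zero_add] at key
    exact key.symm

instance : Sub A where
  sub x y := neg (neg x + y)

instance : CanonicallyOrderedAdd A where
  exists_add_of_le := id
  le_add_self x y := ⟨y, add_comm y x⟩
  le_self_add _ y := ⟨y, rfl⟩

instance : IsOrderedAddMonoid A where
  add_le_add_left := by
    rintro x _ ⟨w, rfl⟩ z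
    exact ⟨w, add_right_comm x w z⟩

theorem sub_def (x y : A) : x - y = neg (neg x + y) :=
  rfl

instance : OrderedSub A where
  tsub_le_iff_right x y z := by
    change le _ _ ↔ le _ _
    rw [le_iff_neg_add_eq_one, le_iff_neg_add_eq_one, sub_def, neg_neg, add_assoc, add_comm y z]

theorem neg_injective : Function.Injective (neg : A → A) :=
  Function.LeftInverse.injective neg_neg

theorem neg_sub (x y : A) : neg (x - y) = neg x + y :=
  neg_neg _

theorem neg_add (x y : A) : neg (x + y) = neg x - y := by
  rw [sub_def, neg_neg]

theorem neg_sub_neg (x y : A) : neg x - neg y = y - x := by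
  rw [sub_def, sub_def, neg_neg, add_comm]

theorem neg_le_neg (h : x ≤ y) : neg y ≤ neg x := by
  rw [← tsub_eq_zero_iff_le] at h ⊢
  rw [neg_sub_neg, h]

theorem le_neg_comm : x ≤ neg y ↔ y ≤ neg x :=
  ⟨fun h => by simpa only [neg_neg] using neg_le_neg h,
   fun h => by simpa only [neg_neg] using neg_le_neg h⟩

theorem sub_add_comm (x y : A) : x - y + y = y - x + x :=
  lukasiewicz x y

theorem sub_sub_self (h : x ≤ y) : y - (y - x) = x := by
  apply neg_injective
  rw [neg_sub, ← neg_sub_neg, add_comm, tsub_add_cancel_of_le (neg_le_neg h)]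

theorem add_sub_cancel (h : x ≤ neg z) : x + z - z = x := by
  apply neg_injective
  rw [neg_sub, neg_add, tsub_add_cancel_of_le (le_neg_comm.1 h)]

theorem sub_le_neg (x y : A) : x - y ≤ neg y :=
  neg_le_neg le_add_self

theorem sub_add_le (hx : x ≤ z) (hy : y ≤ z) : x - y + y ≤ z :=
  (add_le_add_left (tsub_le_tsub_right hx y) y).trans_eq (tsub_add_cancel_of_le hy)

theorem eq_zero_of_le_sub_of_le_sub (hxy : z ≤ x - y) (hyx : z ≤ y - x) : z = 0 := by
  -- `s` is the join of `x` and `y`, with `s - y = x - y` and `s - x = y - x`.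
  let s := x - y + y
  have hs' : s = y - x + x := sub_add_comm x y
  have hx : x ≤ s - z := by
    rw [← sub_sub_self (hs' ▸ le_add_self : x ≤ s)]
    refine tsub_le_tsub_left ?_ s
    rwa [hs', add_sub_cancel (sub_le_neg y x)]
  have hy : y ≤ s - z := by
    rw [← sub_sub_self (le_add_self : y ≤ s)]
    refine tsub_le_tsub_left ?_ s
    rwa [add_sub_cancel (sub_le_neg x y)]
  have hs_le : s ≤ s - z := sub_add_le hx hy
  rw [← sub_sub_self (hxy.trans le_self_add : z ≤ s), tsub_eq_zero_of_le hs_le]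

/-- The proof of an inequality may distinguish the cases `x ≤ y` and `y ≤ x`. -/
theorem le_of_le_sub_add (hxy : z ≤ x - y + w) (hyx : z ≤ y - x + w) : z ≤ w :=
  tsub_eq_zero_iff_le.1 <| eq_zero_of_le_sub_of_le_sub
    (tsub_le_iff_right.2 hxy) (tsub_le_iff_right.2 hyx)

theorem le_neg_of_le_neg_self (hx : x ≤ neg x) (hy : y ≤ neg y) : x ≤ neg y := by
  apply le_of_le_sub_add (x := x) (y := y)
  · exact le_tsub_add.trans (add_le_add_right hy _)
  · calc x ≤ neg x := hx
      _ ≤ neg x - neg y + neg y := le_tsub_add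
      _ = y - x + neg y := by rw [neg_sub_neg]

theorem le_neg_add (hxy : x ≤ neg y) (hz : x + y ≤ neg z) : x ≤ neg (y + z) := by
  rw [le_neg_comm]
  calc y + z ≤ y + neg (x + y) := add_le_add_right (le_neg_comm.1 hz) y
    _ = neg x - y + y := by rw [neg_add, add_comm]
    _ = neg x := tsub_add_cancel_of_le (le_neg_comm.1 hxy)

end Arithmetic

section Radical

variable {A : Type u} [MVAlgebra A] {x y : A}

theorem mem_rad_iff : x ∈ rad A ↔ ∀ n : ℕ, n • x ≤ neg x := by
  refine ⟨fun hx n => ?_, fun h n _ => h n⟩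
  rcases n.eq_zero_or_pos with rfl | hn
  · rw [zero_nsmul]
    exact zero_le
  · exact hx n hn

theorem nsmul_le_neg_nsmul (hx : x ∈ rad A) (m n : ℕ) : m • x ≤ neg (n • x) := by
  induction n generalizing m with
  | zero =>
    rw [zero_nsmul, le_neg_comm]
    exact zero_le
  | succ n ih =>
    rw [succ_nsmul]
    refine le_neg_add (ih m) ?_
    rw [← add_nsmul]
    exact mem_rad_iff.1 hx _

theorem nsmul_le_neg_nsmul_of_mem_rad (hx : x ∈ rad A) (hy : y ∈ rad A) (n : ℕ) :
    n • x ≤ neg (n • y) :=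
  le_neg_of_le_neg_self (nsmul_le_neg_nsmul hx n n) (nsmul_le_neg_nsmul hy n n)

theorem mem_rad_of_le (hxy : x ≤ y) (hy : y ∈ rad A) : x ∈ rad A :=
  mem_rad_iff.2 fun n =>
    (nsmul_le_nsmul_right hxy n).trans ((mem_rad_iff.1 hy n).trans (neg_le_neg hxy))

theorem add_mem_rad (hx : x ∈ rad A) (hy : y ∈ rad A) : x + y ∈ rad A := by
  refine mem_rad_iff.2 fun n => ?_
  have hxy : (n + 1) • x ≤ neg ((n + 1) • y) := nsmul_le_neg_nsmul_of_mem_rad hx hy (n + 1)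
  have hyx : n • y + y ≤ neg x := by
    rw [← succ_nsmul, le_neg_comm]
    exact (succ_nsmul x n ▸ le_add_self : x ≤ (n + 1) • x).trans hxy
  have hy_add : x + y ≤ neg (n • y) := by
    rw [le_neg_comm, add_comm x y]
    exact le_neg_add (mem_rad_iff.1 hy n) hyx
  have hx_add : x + y + n • y ≤ neg (n • x) := by
    rw [le_neg_comm, add_assoc, add_comm y, ← succ_nsmul]
    refine le_neg_add (mem_rad_iff.1 hx n) ?_
    rwa [← succ_nsmul]
  rw [nsmul_add, le_neg_comm, add_comm (n • x)]
  exact le_neg_add hy_add hx_add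

theorem le_neg_of_mem_rad (hx : x ∈ rad A) (hy : y ∈ rad A) : x ≤ neg y := by
  simpa only [one_nsmul] using nsmul_le_neg_nsmul_of_mem_rad hx hy 1

variable (A) in
/-- The radical of an MV-algebra as an additive submonoid. With the induced order and truncated
subtraction it is the positive cone of an abelian ℓ-group. -/
def radical : AddSubmonoid A where
  carrier := rad A
  zero_mem' := mem_rad_iff.2 fun n => by
    rw [nsmul_zero]
    exact zero_le
  add_mem' := add_mem_rad

theorem sub_mem_radical (hx : x ∈ radical A) (y : A) : x - y ∈ radical A :=
  mem_rad_of_le tsub_le_self hx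

instance : Sub (radical A) where
  sub r s := ⟨r - s, sub_mem_radical r.2 s⟩

instance : OrderedSub (radical A) where
  tsub_le_iff_right r s t := tsub_le_iff_right (α := A) (a := r) (b := s) (c := t)

instance : CanonicallyOrderedAdd (radical A) where
  exists_add_of_le {r s} h := ⟨s - r, Subtype.ext (add_tsub_cancel_of_le (α := A) h).symm⟩
  le_add_self _ _ := le_add_self (α := A)
  le_self_add _ _ := le_self_add (α := A)

instance : IsOrderedCancelAddMonoid (radical A) where
  add_le_add_left _ _ h t := add_le_add_left (α := A) h t
  le_of_add_le_add_left r s t h := by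
    have hsub : (r + s - r : A) ≤ r + t - r := tsub_le_tsub_right h _
    rwa [add_comm (r : A), add_comm (r : A), add_sub_cancel (le_neg_of_mem_rad s.2 r.2),
      add_sub_cancel (le_neg_of_mem_rad t.2 r.2)] at hsub

theorem neg_coe_add_coe (r s : radical A) : neg (r : A) + s = neg ((r - s : radical A) : A) :=
  (neg_sub _ _).symm

theorem neg_coe_add_neg_coe (r s : radical A) : neg (r : A) + neg (s : A) = one := by
  rw [← le_iff_neg_add_eq_one]
  exact le_neg_of_mem_rad r.2 s.2

namespace IsPerfect

theorem mem_radical_or_neg_mem_radical (hA : IsPerfect A) (x : A) :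
    x ∈ radical A ∨ neg x ∈ radical A := by
  induction hA.2 x with
  | of hx => exact .inl hx
  | zero => exact .inl (zero_mem _)
  | one => exact .inr (neg_one (A := A) ▸ zero_mem _)
  | neg _ ih =>
    rw [neg_neg]
    exact ih.symm
  | @oplus x y _ _ ihx ihy =>
    rcases ihx, ihy with ⟨hx | hx, hy | hy⟩
    · exact .inl (add_mem hx hy)
    · exact .inr (mem_rad_of_le (neg_le_neg le_add_self) hy)
    all_goals exact .inr (mem_rad_of_le (neg_le_neg le_self_add) hx)

theorem neg_notMem_radical (hA : IsPerfect A) (hx : x ∈ radical A) : neg x ∉ radical A := by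
  intro hneg
  have hone : one ∈ rad A := neg_add_self x ▸ add_mem_rad hneg hx
  refine hA.1 (le_antisymm (zero_le (α := A)) ?_)
  calc one ≤ neg one := le_neg_of_mem_rad hone hone
    _ = zero := neg_one

theorem exists_radical_eq (hA : IsPerfect A) (x : A) :
    ∃ r : radical A, x = r ∨ x = neg (r : A) := by
  rcases hA.mem_radical_or_neg_mem_radical x with hx | hx
  · exact ⟨⟨x, hx⟩, .inl rfl⟩
  · exact ⟨⟨neg x, hx⟩, .inr (neg_neg x).symm⟩

end IsPerfect

end Radical

end MVAlgebra

theorem map_tsub_of_addEquiv {M N : Type*} [AddCommMonoid M] [PartialOrder M]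
    [CanonicallyOrderedAdd M] [Sub M] [OrderedSub M] [AddCommMonoid N] [PartialOrder N]
    [CanonicallyOrderedAdd N] [Sub N] [OrderedSub N] (e : M ≃+ N) (x y : M) :
    e (x - y) = e x - e y := by
  have h_le (a b : M) : e a ≤ e b ↔ a ≤ b := by
    simp only [le_iff_exists_add, e.surjective.exists, ← map_add, e.injective.eq_iff]
  exact OrderIso.map_tsub ⟨e.toEquiv, h_le _ _⟩ (map_add e) x y

namespace MVAlg

open MVAlgebra (radical IsPerfect)

variable {A B : MVAlg.{u}}

namespace Hom

/-- An MV-algebra homomorphism as a homomorphism of additive monoids. -/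
def toAddMonoidHom (f : Hom A B) : A.carrier →+ B.carrier where
  toFun := f.toFun
  map_zero' := f.map_zero
  map_add' := f.map_oplus

theorem map_sub (f : Hom A B) (x y : A.carrier) : f.toFun (x - y) = f.toFun x - f.toFun y := by
  calc f.toFun (x - y) = MVAlgebra.neg (f.toFun (MVAlgebra.neg x) + f.toFun y) :=
      (f.map_neg _).trans (congrArg MVAlgebra.neg (f.map_oplus _ _))
    _ = f.toFun x - f.toFun y := by rw [f.map_neg, MVAlgebra.sub_def]

theorem monotone (f : Hom A B) : Monotone f.toFun := by
  rintro x _ ⟨z, rfl⟩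
  exact ⟨f.toFun z, f.map_oplus x z⟩

theorem map_mem_radical (f : Hom A B) {x : A.carrier} (hx : x ∈ radical A.carrier) :
    f.toFun x ∈ radical B.carrier := by
  refine MVAlgebra.mem_rad_iff.2 fun n => ?_
  rw [← f.map_neg]
  exact (map_nsmul f.toAddMonoidHom n x).symm.trans_le
    (f.monotone (MVAlgebra.mem_rad_iff.1 hx n))

/-- The restriction of an MV-algebra homomorphism to the radicals. -/
def mapRadical (f : Hom A B) : radical A.carrier →+ radical B.carrier :=
  f.toAddMonoidHom.restrict fun _ => f.map_mem_radical

theorem mapRadical_sub (f : Hom A B) (r s : radical A.carrier) :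
    f.mapRadical (r - s) = f.mapRadical r - f.mapRadical s :=
  Subtype.ext (f.map_sub r s)

theorem mapRadical_id (A : MVAlg.{u}) : mapRadical (𝟙 A) = AddMonoidHom.id _ :=
  rfl

theorem mapRadical_comp {A B C : MVAlg.{u}} (f : A ⟶ B) (g : B ⟶ C) :
    mapRadical (f ≫ g) = (mapRadical g).comp (mapRadical f) :=
  rfl

theorem ext_of_mapRadical (hA : IsPerfect A.carrier) {f g : Hom A B}
    (h : f.mapRadical = g.mapRadical) : f = g := by
  have h_rad (r : radical A.carrier) : f.toFun r = g.toFun r :=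
    congrArg Subtype.val (DFunLike.congr_fun h r)
  refine Hom.ext (funext fun x => ?_)
  obtain ⟨r, rfl | rfl⟩ := hA.exists_radical_eq x
  · exact h_rad r
  · rw [f.map_neg, g.map_neg, h_rad]

end Hom

section Extension

variable (hA : IsPerfect A.carrier) (φ : radical A.carrier →+ radical B.carrier)

open Classical in
/-- The extension of a map between radicals to a perfect MV-algebra by `¬r ↦ ¬(φ r)`. -/
noncomputable def extendFun (x : A.carrier) : B.carrier :=
  if hx : x ∈ radical A.carrier then φ ⟨x, hx⟩
  else MVAlgebra.neg (φ ⟨MVAlgebra.neg x, (hA.mem_radical_or_neg_mem_radical x).resolve_left hx⟩)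

theorem extendFun_coe (r : radical A.carrier) : extendFun hA φ r = φ r :=
  dif_pos r.2

theorem extendFun_neg_coe (r : radical A.carrier) :
    extendFun hA φ (MVAlgebra.neg r) = MVAlgebra.neg (φ r : B.carrier) := by
  rw [extendFun, dif_neg (hA.neg_notMem_radical r.2)]
  simp only [MVAlgebra.neg_neg]

theorem extendFun_one : extendFun hA φ MVAlgebra.one = MVAlgebra.one := by
  rw [← MVAlgebra.neg_zero, ← MVAlgebra.neg_zero]
  refine (extendFun_neg_coe hA φ 0).trans ?_
  rw [map_zero]
  rfl

theorem extendFun_add (hφ : ∀ r s, φ (r - s) = φ r - φ s) (x y : A.carrier) :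
    extendFun hA φ (x + y) = extendFun hA φ x + extendFun hA φ y := by
  have h_neg_coe (r s : radical A.carrier) : extendFun hA φ (MVAlgebra.neg (r : A.carrier) + s) =
      extendFun hA φ (MVAlgebra.neg r) + extendFun hA φ s := by
    rw [MVAlgebra.neg_coe_add_coe, extendFun_neg_coe, extendFun_neg_coe, extendFun_coe, hφ,
      MVAlgebra.neg_coe_add_coe]
  obtain ⟨r, rfl | rfl⟩ := hA.exists_radical_eq x <;>
    obtain ⟨s, rfl | rfl⟩ := hA.exists_radical_eq y
  · rw [← AddSubmonoid.coe_add, extendFun_coe, extendFun_coe, extendFun_coe, map_add,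
      AddSubmonoid.coe_add]
  · rw [add_comm, h_neg_coe, add_comm]
  · exact h_neg_coe r s
  · rw [MVAlgebra.neg_coe_add_neg_coe, extendFun_neg_coe, extendFun_neg_coe,
      MVAlgebra.neg_coe_add_neg_coe, extendFun_one]

/-- The unique extension to a perfect MV-algebra of an additive map between radicals that preserves
truncated differences. -/
noncomputable def extend (hφ : ∀ r s, φ (r - s) = φ r - φ s) : Hom A B where
  toFun := extendFun hA φ
  map_oplus := extendFun_add hA φ hφ
  map_zero := (extendFun_coe hA φ 0).trans (congrArg Subtype.val φ.map_zero)
  map_one := extendFun_one hA φ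
  map_neg x := by
    obtain ⟨r, rfl | rfl⟩ := hA.exists_radical_eq x
    · rw [extendFun_neg_coe, extendFun_coe]
    · rw [extendFun_neg_coe, MVAlgebra.neg_neg, MVAlgebra.neg_neg, extendFun_coe]

theorem mapRadical_extend (hφ : ∀ r s, φ (r - s) = φ r - φ s) : (extend hA φ hφ).mapRadical = φ :=
  AddMonoidHom.ext fun r => Subtype.ext (extendFun_coe hA φ r)

end Extension

section Iso

variable (hA : IsPerfect A.carrier) (hB : IsPerfect B.carrier)

/-- Perfect MV-algebras with isomorphic radicals are isomorphic. -/
noncomputable def isoOfRadicalEquiv (e : radical A.carrier ≃+ radical B.carrier) : A ≅ B where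
  hom := extend hA e.toAddMonoidHom fun r s => by
    simpa only [AddEquiv.toAddMonoidHom_eq_coe, AddMonoidHom.coe_coe] using
      map_tsub_of_addEquiv e r s
  inv := extend hB e.symm.toAddMonoidHom fun r s => by
    simpa only [AddEquiv.toAddMonoidHom_eq_coe, AddMonoidHom.coe_coe] using
      map_tsub_of_addEquiv e.symm r s
  hom_inv_id := Hom.ext_of_mapRadical hA <| by
    rw [Hom.mapRadical_comp, mapRadical_extend, mapRadical_extend, Hom.mapRadical_id]
    exact AddMonoidHom.ext e.symm_apply_apply
  inv_hom_id := Hom.ext_of_mapRadical hB <| by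
    rw [Hom.mapRadical_comp, mapRadical_extend, mapRadical_extend, Hom.mapRadical_id]
    exact AddMonoidHom.ext e.apply_symm_apply

end Iso

end MVAlg

/-- The lattice structure of a partially ordered abelian group in which every element has a
positive part. -/
@[reducible]
noncomputable def latticeOfExistsPosPart {G : Type*} [AddCommGroup G] [PartialOrder G]
    [IsOrderedAddMonoid G] (h : ∀ x : G, ∃ p, IsLUB {x, 0} p) : Lattice G where
  sup x y := (h (x - y)).choose + y
  le_sup_left x y := sub_le_iff_le_add.1 <| (h (x - y)).choose_spec.1 (Set.mem_insert _ _)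
  le_sup_right x y :=
    le_add_of_nonneg_left <| (h (x - y)).choose_spec.1 (Set.mem_insert_of_mem _ rfl)
  sup_le x y z hx hy := by
    refine le_sub_iff_add_le.1 ((h (x - y)).choose_spec.2 ?_)
    rintro _ (rfl | rfl)
    exacts [sub_le_sub_right hx y, sub_nonneg.2 hy]
  inf x y := x - (h (x - y)).choose
  inf_le_left x y := sub_le_self _ <| (h (x - y)).choose_spec.1 (Set.mem_insert_of_mem _ rfl)
  inf_le_right x y := sub_le_comm.1 <| (h (x - y)).choose_spec.1 (Set.mem_insert _ _)
  le_inf x y z hy hz := by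
    refine le_sub_comm.1 ((h (y - z)).choose_spec.2 ?_)
    rintro _ (rfl | rfl)
    exacts [sub_le_sub_left hz y, sub_nonneg.2 hy]

namespace AbLGroup

namespace differenceGroup

open Algebra GrothendieckAddGroup

variable {M : Type*} [AddCommMonoid M]

theorem exists_of_sub_of_eq (x : GrothendieckAddGroup M) : ∃ a b : M, of a - of b = x := by
  induction x using AddLocalization.ind with
  | H y =>
    refine ⟨y.1, y.2, ?_⟩
    rw [sub_eq_iff_eq_add]
    simp only [of, AddSubmonoid.LocalizationMap.toAddMonoidHom_apply,
      ← AddLocalization.mk_zero_eq_addMonoidOf_mk, AddLocalization.mk_add]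
    rw [AddLocalization.mk_eq_mk_iff, AddLocalization.r_iff_exists]
    exact ⟨0, by simp [add_comm]⟩

variable [PartialOrder M] [IsOrderedCancelAddMonoid M]

theorem of_le_of_iff {a b : M} : (of a : GrothendieckAddGroup M) ≤ of b ↔ a ≤ b :=
  (AddLocalization.mkOrderEmbedding (0 : (⊤ : AddSubmonoid M))).le_iff_le

theorem of_nonneg_of [CanonicallyOrderedAdd M] (a : M) : 0 ≤ (of a : GrothendieckAddGroup M) := by
  rw [← map_zero of, of_le_of_iff]
  exact zero_le

theorem exists_of_eq_of_nonneg [CanonicallyOrderedAdd M] {x : GrothendieckAddGroup M}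
    (hx : 0 ≤ x) : ∃ a : M, of a = x := by
  obtain ⟨a, b, rfl⟩ := exists_of_sub_of_eq x
  obtain ⟨c, rfl⟩ := exists_add_of_le (of_le_of_iff.1 (sub_nonneg.1 hx))
  exact ⟨c, by rw [map_add, add_sub_cancel_left]⟩

theorem isLUB_of_tsub [CanonicallyOrderedAdd M] [Sub M] [OrderedSub M] (a b : M) :
    IsLUB {of a - of b, 0} (of (a - b) : GrothendieckAddGroup M) := by
  constructor
  · rintro _ (rfl | rfl)
    · rw [sub_le_iff_le_add, ← map_add, of_le_of_iff]
      exact le_tsub_add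
    · exact of_nonneg_of _
  · intro z hz
    obtain ⟨c, rfl⟩ := exists_of_eq_of_nonneg (hz (Set.mem_insert_of_mem _ rfl))
    have hac : of a - of b ≤ of c := hz (Set.mem_insert _ _)
    rw [sub_le_iff_le_add, ← map_add, of_le_of_iff] at hac
    rw [of_le_of_iff]
    exact tsub_le_iff_right.2 hac

end differenceGroup

section DifferenceGroup

open Algebra GrothendieckAddGroup differenceGroup

variable (M : Type u) [AddCommMonoid M] [PartialOrder M] [IsOrderedCancelAddMonoid M]
  [CanonicallyOrderedAdd M] [Sub M] [OrderedSub M]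

/-- The ℓ-group of formal differences of elements of `M`. -/
noncomputable def differenceGroup : AbLGroup.{u} where
  carrier := GrothendieckAddGroup M
  lattice := latticeOfExistsPosPart fun x => by
    obtain ⟨a, b, rfl⟩ := exists_of_sub_of_eq x
    exact ⟨_, isLUB_of_tsub a b⟩
  isOrdered := IsOrderedCancelAddMonoid.toIsOrderedAddMonoid (α := GrothendieckAddGroup M)

/-- A canonically ordered cancellative monoid with truncated subtraction is the positive cone of its
ℓ-group of differences. -/
noncomputable def differenceGroupNonnegEquiv :
    M ≃+ AddSubmonoid.nonneg (differenceGroup M).carrier :=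
  AddEquiv.ofBijective
    ((of (M := M)).codRestrict (AddSubmonoid.nonneg (GrothendieckAddGroup M)) of_nonneg_of)
    ⟨fun _ _ h => of_injective (congrArg Subtype.val h), fun ⟨_, hx⟩ =>
      (exists_of_eq_of_nonneg hx).imp fun _ => Subtype.ext⟩

end DifferenceGroup

section PositiveCone

variable {G : Type*} [AddCommGroup G] [Lattice G] [IsOrderedAddMonoid G]

/-- Truncated subtraction on the positive cone. -/
instance : Sub (AddSubmonoid.nonneg G) where
  sub a b := ⟨(a - b : G)⁺, posPart_nonneg _⟩

theorem coe_nonneg_sub (a b : AddSubmonoid.nonneg G) :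
    ((a - b : AddSubmonoid.nonneg G) : G) = (a - b : G)⁺ :=
  rfl

instance : OrderedSub (AddSubmonoid.nonneg G) where
  tsub_le_iff_right a b c := by
    rw [← Subtype.coe_le_coe, coe_nonneg_sub, posPart_def, sup_le_iff, sub_le_iff_le_add,
      and_iff_left (show (0 : G) ≤ c from c.2)]
    rfl

instance : CanonicallyOrderedAdd (AddSubmonoid.nonneg G) where
  exists_add_of_le {a b} h := ⟨⟨b - a, sub_nonneg.2 h⟩, Subtype.ext (add_sub_cancel (a : G) b).symm⟩
  le_add_self _ b := le_add_of_nonneg_left (α := G) b.2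
  le_self_add _ b := le_add_of_nonneg_right (α := G) b.2

variable {H : Type*} [AddCommGroup H]

/-- The extension to all of `G` of an additive map on its positive cone. -/
def extendNonneg (φ : AddSubmonoid.nonneg G →+ H) : G →+ H :=
  .mk' (fun x => φ ⟨x⁺, posPart_nonneg x⟩ - φ ⟨x⁻, negPart_nonneg x⟩) fun x y => by
    rw [sub_add_sub_comm, sub_eq_sub_iff_add_eq_add, ← map_add, ← map_add, ← map_add, ← map_add]
    congr 1
    ext
    change (x + y)⁺ + (x⁻ + y⁻) = x⁺ + y⁺ + (x + y)⁻
    rw [← sub_eq_sub_iff_add_eq_add, posPart_sub_negPart, add_sub_add_comm, posPart_sub_negPart,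
      posPart_sub_negPart]

theorem extendNonneg_coe (φ : AddSubmonoid.nonneg G →+ H) (a : AddSubmonoid.nonneg G) :
    extendNonneg φ a = φ a := by
  have h_pos : (⟨(a : G)⁺, posPart_nonneg _⟩ : AddSubmonoid.nonneg G) = a :=
    Subtype.ext (posPart_of_nonneg a.2)
  have h_neg : (⟨(a : G)⁻, negPart_nonneg _⟩ : AddSubmonoid.nonneg G) = 0 :=
    Subtype.ext (negPart_of_nonneg a.2)
  change φ _ - φ _ = _
  rw [h_pos, h_neg, map_zero, sub_zero]

end PositiveCone

namespace Hom

variable {G H : AbLGroup.{u}}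

/-- An additive map preserving positive parts as a homomorphism of ℓ-groups. -/
def ofPosPart (f : G.carrier →+ H.carrier) (hf : ∀ x, f x⁺ = (f x)⁺) : Hom G H where
  toFun := f
  map_add := f.map_add
  map_sup x y := by
    rw [sup_eq_add_posPart_sub, sup_eq_add_posPart_sub, _root_.map_add, hf, _root_.map_sub]
  map_inf x y := by
    rw [inf_eq_sub_posPart_sub, inf_eq_sub_posPart_sub, _root_.map_sub, hf, _root_.map_sub]

/-- The restriction of a homomorphism of ℓ-groups to the positive cones. -/
def mapNonneg (f : Hom G H) : AddSubmonoid.nonneg G.carrier →+ AddSubmonoid.nonneg H.carrier :=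
  f.toAddMonoidHom.restrict fun _ hx => f.map_zero.symm.trans_le (f.monotone hx)

theorem ext_of_mapNonneg {f g : Hom G H} (h : f.mapNonneg = g.mapNonneg) : f = g := by
  have h_nonneg (x : G.carrier) (hx : 0 ≤ x) : f.toFun x = g.toFun x :=
    congrArg Subtype.val (DFunLike.congr_fun h (⟨x, hx⟩ : AddSubmonoid.nonneg G.carrier))
  refine Hom.ext (funext fun x => ?_)
  rw [← posPart_sub_negPart x, f.map_sub, g.map_sub, h_nonneg _ (posPart_nonneg x),
    h_nonneg _ (negPart_nonneg x)]

section Extension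

variable (φ : AddSubmonoid.nonneg G.carrier →+ AddSubmonoid.nonneg H.carrier)

/-- The extension to an ℓ-group of a map between positive cones preserving truncated differences. -/
def ofNonneg (hφ : ∀ a b, φ (a - b) = φ a - φ b) : Hom G H :=
  ofPosPart (extendNonneg ((AddSubmonoid.nonneg H.carrier).subtype.comp φ)) fun x => by
    set p : AddSubmonoid.nonneg G.carrier := ⟨x⁺, posPart_nonneg x⟩
    set n : AddSubmonoid.nonneg G.carrier := ⟨x⁻, negPart_nonneg x⟩
    have hpn : p - n = p := Subtype.ext (congrArg (·⁺) (posPart_sub_negPart x))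
    calc extendNonneg ((AddSubmonoid.nonneg H.carrier).subtype.comp φ) (p : G.carrier)
        = ((φ p : H.carrier)) := extendNonneg_coe _ p
      _ = (φ p - φ n : H.carrier)⁺ := by rw [← coe_nonneg_sub, ← hφ, hpn]

theorem mapNonneg_ofNonneg (hφ : ∀ a b, φ (a - b) = φ a - φ b) : (ofNonneg φ hφ).mapNonneg = φ :=
  AddMonoidHom.ext fun a => Subtype.ext (extendNonneg_coe _ a)

end Extension

end Hom

end AbLGroup

theorem toLex_inf_toLex_of_lt {G : Type u} [Lattice G] {m n : ℤ} (h : m < n) (a b : G) :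
    (lexLattice G).inf (toLex (m, a)) (toLex (n, b)) = toLex (m, a) :=
  if_pos h

namespace AbLGroup

open MVAlgebra (radical)

variable {G H : AbLGroup.{u}}

variable (G) in
/-- The MV-algebra underlying `Δ(G)`. -/
noncomputable abbrev mvAlg : MVAlg.{u} :=
  (Delta.obj G).obj

/-- The element `(0, g)` of `Δ(G)`. -/
noncomputable def infinitesimal (g : AddSubmonoid.nonneg G.carrier) : G.mvAlg.carrier :=
  letI := lexLattice G.carrier
  (⟨toLex (0, (g : G.carrier)), Prod.Lex.le_iff.2 (.inr ⟨rfl, g.2⟩),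
    Prod.Lex.le_iff.2 (.inl one_pos)⟩ : Set.Icc (0 : ℤ ×ₗ G.carrier) (toLex (1, 0)))

theorem infinitesimal_injective : Function.Injective (infinitesimal (G := G)) := fun _ _ e =>
  letI := lexLattice G.carrier
  Subtype.ext <| congrArg
    (fun x : Set.Icc (0 : ℤ ×ₗ G.carrier) (toLex (1, 0)) => (ofLex x.1).2) e

theorem infinitesimal_add (g h : AddSubmonoid.nonneg G.carrier) :
    infinitesimal (g + h) = infinitesimal g + infinitesimal h :=
  letI := lexLattice G.carrier
  Subtype.ext (toLex_inf_toLex_of_lt (zero_lt_one : (0 + 0 : ℤ) < 1) (g + h : G.carrier) 0).symm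

theorem infinitesimal_mem_radical (g : AddSubmonoid.nonneg G.carrier) :
    infinitesimal g ∈ radical G.mvAlg.carrier := by
  let _ := lexLattice G.carrier
  refine intervalMV_infinitesimal (G := ℤ ×ₗ G.carrier) (u := toLex (1, 0))
    (Prod.Lex.le_iff.2 (.inl one_pos)) _ fun n => Prod.Lex.le_iff.2 (.inl ?_)
  change n • (0 : ℤ) < 1
  rw [smul_zero]
  exact one_pos

theorem exists_infinitesimal_eq (x : G.mvAlg.carrier) :
    ∃ g, infinitesimal g = x ∨ MVAlgebra.neg (infinitesimal g) = x := by
  let _ := lexLattice G.carrier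
  obtain ⟨⟨n, g⟩, h_zero_le, h_le_one⟩ := (x : Set.Icc (0 : ℤ ×ₗ G.carrier) (toLex (1, 0)))
  rcases Prod.Lex.le_iff.1 h_zero_le with hn_pos | ⟨hn : 0 = n, hg : 0 ≤ g⟩
  · rcases Prod.Lex.le_iff.1 h_le_one with hn_lt | ⟨hn : n = 1, hg : g ≤ 0⟩
    · exact absurd hn_lt (not_lt.2 (Int.add_one_le_of_lt hn_pos))
    · refine ⟨⟨-g, neg_nonneg.2 hg⟩, .inr (Subtype.ext ?_)⟩
      have hn_sub : (1 : ℤ) - 0 = n := (sub_zero 1).trans hn.symm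
      exact congrArg toLex (Prod.ext hn_sub ((zero_sub _).trans (neg_neg g)))
  · exact ⟨⟨g, hg⟩, .inl (Subtype.ext (congrArg toLex (Prod.ext hn rfl)))⟩

theorem exists_infinitesimal_eq_of_mem_radical {x : G.mvAlg.carrier}
    (hx : x ∈ radical G.mvAlg.carrier) : ∃ g, infinitesimal g = x := by
  obtain ⟨g, rfl | rfl⟩ := exists_infinitesimal_eq x
  · exact ⟨g, rfl⟩
  · exact absurd hx ((perfect_gamma_lexZ G).neg_notMem_radical (infinitesimal_mem_radical g))

variable (G) in
/-- The positive cone of `G` is the radical of `Δ(G)`. -/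
noncomputable def nonnegEquivRadical : AddSubmonoid.nonneg G.carrier ≃+ radical G.mvAlg.carrier :=
  AddEquiv.ofBijective
    (AddMonoidHom.codRestrict
      { toFun := infinitesimal, map_zero' := rfl, map_add' := infinitesimal_add } _
      infinitesimal_mem_radical)
    ⟨fun _ _ e => infinitesimal_injective (congrArg Subtype.val e), fun ⟨_, hx⟩ =>
      (exists_infinitesimal_eq_of_mem_radical hx).imp fun _ => Subtype.ext⟩

theorem mapRadical_Delta_map (f : G ⟶ H) (g : AddSubmonoid.nonneg G.carrier) :
    (Delta.map f).hom.mapRadical (nonnegEquivRadical G g) =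
      nonnegEquivRadical H (Hom.mapNonneg f g) :=
  rfl

end AbLGroup

open AbLGroup

instance : Delta.{u}.Faithful where
  map_injective {G H f g} h := Hom.ext_of_mapNonneg <| AddMonoidHom.ext fun a =>
    (nonnegEquivRadical H).injective <| by
      rw [← mapRadical_Delta_map, ← mapRadical_Delta_map, h]

instance : Delta.{u}.Full where
  map_surjective {G H} h := by
    let φ := (nonnegEquivRadical H).symm.toAddMonoidHom.comp
      (h.hom.mapRadical.comp (nonnegEquivRadical G).toAddMonoidHom)
    have hφ (a b) : φ (a - b) = φ a - φ b := by
      change (nonnegEquivRadical H).symm (h.hom.mapRadical (nonnegEquivRadical G (a - b))) = _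
      rw [map_tsub_of_addEquiv, MVAlg.Hom.mapRadical_sub, map_tsub_of_addEquiv]
      rfl
    refine ⟨Hom.ofNonneg φ hφ, ObjectProperty.hom_ext _ <|
      MVAlg.Hom.ext_of_mapRadical (Delta.obj G).property <| AddMonoidHom.ext fun r => ?_⟩
    obtain ⟨a, rfl⟩ := (nonnegEquivRadical G).surjective r
    rw [mapRadical_Delta_map, Hom.mapNonneg_ofNonneg]
    exact (nonnegEquivRadical H).apply_symm_apply _

instance : Delta.{u}.EssSurj where
  mem_essImage A :=
    let G := differenceGroup (MVAlgebra.radical A.obj.carrier)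
    ⟨G, ⟨MVAlg.perfect.isoMk <| MVAlg.isoOfRadicalEquiv (Delta.obj G).property A.property <|
      (nonnegEquivRadical G).symm.trans (differenceGroupNonnegEquiv _).symm⟩⟩

theorem mainTheorem1 :
    rho.{u}.IsEquivalence ∧ Delta.{u}.IsEquivalence ∧ (rho.{u} ⋙ Delta.{u}).IsEquivalence := by
  have : rho.{u}.IsEquivalence := {}
  have : Delta.{u}.IsEquivalence := {}
  exact ⟨inferInstance, inferInstance, inferInstance⟩
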